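/- All topological groups are assumed Hausdorff. A map $f:X\to Y$ of topological spaces is called perfect if it is continuous, closed and onto and all its fibres $f^{-1}(y)$ are compact. A topological group $G$ is called $P\mathcal{M}$-factorizable (respectively, $P\mathbb{R}$-factorizable) if for every continuous function $f:G\to\mathbb{R}$ there exist a perfect homomorphism $\pi:G\to H$ onto a metrizable (respectively, second-countable) topological group $H$ and a continuous function $g:H\to\mathbb{R}$ such that $f=g\circ\pi$. Theorem 4.2. Let $(G_i)_{i\in I}$ be a countable (finite or infinite) family of $P\mathcal{M}$-factorizable topological groups, and let $G=\prod_{i\in I}G_i$ be their product with the product topology. Then $G$ is $P\mathcal{M}$-factorizable if and only if either every $G_i$ is metrizable or every $G_i$ is $P\mathbb{R}$-factorizable. -/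

import Mathlib

universe u v

/-- A perfect map: a continuous closed surjection all of whose fibres are compact. -/
structure IsPerfectMap {X Y : Type*} [TopologicalSpace X] [TopologicalSpace Y]
    (f : X → Y) : Prop where
  continuous : Continuous f
  isClosedMap : IsClosedMap f
  surjective : Function.Surjective f
  isCompact_fiber : ∀ y : Y, IsCompact (f ⁻¹' {y})

/-- `G` is `PM`-factorizable: every continuous `f : G → ℝ` factors as `f = g ∘ π` with
`π : G → H` a perfect homomorphism onto a metrizable topological group `H` and `g : H → ℝ`
continuous. (As `H` is a homomorphic image of `G`, nothing is lost by taking `H` in the universe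
of `G`.) -/
def PMFactorizable (G : Type u) [Group G] [TopologicalSpace G] : Prop :=
  ∀ f : G → ℝ, Continuous f →
    ∃ (H : Type u) (_ : Group H) (_ : TopologicalSpace H) (_ : IsTopologicalGroup H)
      (_ : TopologicalSpace.MetrizableSpace H) (π : G →* H) (g : H → ℝ),
      IsPerfectMap π ∧ Continuous g ∧ f = g ∘ π

/-- `G` is `PR`-factorizable: every continuous `f : G → ℝ` factors as `f = g ∘ π` with
`π : G → H` a perfect homomorphism onto a second-countable Hausdorff topological group `H` and
`g : H → ℝ` continuous. -/
def PRFactorizable (G : Type u) [Group G] [TopologicalSpace G] : Prop :=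
  ∀ f : G → ℝ, Continuous f →
    ∃ (H : Type u) (_ : Group H) (_ : TopologicalSpace H) (_ : IsTopologicalGroup H)
      (_ : T2Space H) (_ : SecondCountableTopology H) (π : G →* H) (g : H → ℝ),
      IsPerfectMap π ∧ Continuous g ∧ f = g ∘ π

open Filter Topology Set TopologicalSpace Pointwise

/-! ### Perfect and proper maps. -/

section Perfect

/-! The key is that a `PM`-factorizable group is metrizable or Lindelöf. Take a perfect `π : G → H`
with kernel `K` and `H` not second countable. If the restrictions to `K` of functions on `G` are
separable, countably many functions separate `1` in `K`, and `G` is metrizable. Otherwise, write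
uncountably many separated restrictions on separated cosets of `K`. A perfect `p` factoring the
glued function would put an uncountable separated family in the separable space `C(p(K), ℝ)`.

Conversely, a countable product of `PR`-factorizable groups is Lindelöf, being a proper preimage of
a second-countable group. On a Lindelöf group each real function factors through a metrizable group,
and pairing with the proper map makes the factorization perfect. -/

theorem isPerfectMap_iff {X Y : Type*} [TopologicalSpace X] [TopologicalSpace Y] {f : X → Y} :
    IsPerfectMap f ↔ IsProperMap f ∧ Function.Surjective f := by
  rw [isProperMap_iff_isClosedMap_and_compact_fibers]
  exact ⟨fun h => ⟨⟨h.1, h.2, fun {y} => h.4 y⟩, h.3⟩, fun h => ⟨h.1.1, h.1.2.1, h.2, h.1.2.2⟩⟩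

theorem IsPerfectMap.isProperMap {X Y : Type*} [TopologicalSpace X] [TopologicalSpace Y]
    {f : X → Y} (hf : IsPerfectMap f) : IsProperMap f := (isPerfectMap_iff.1 hf).1

/-- The preimage of a Lindelöf space under a proper map is Lindelöf. -/
theorem IsProperMap.lindelofSpace {X Y : Type*} [TopologicalSpace X] [TopologicalSpace Y]
    {f : X → Y} (hf : IsProperMap f) [LindelofSpace Y] : LindelofSpace X := by
  obtain ⟨-, hc, hk⟩ := isProperMap_iff_isClosedMap_and_compact_fibers.1 hf
  refine ⟨isLindelof_of_countable_subcover fun {ι} U hUo hU => ?_⟩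
  have hfin : ∀ y, ∃ t : Finset ι, f ⁻¹' {y} ⊆ ⋃ i ∈ t, U i := fun y =>
    (hk (y := y)).elim_finite_subcover U hUo ((subset_univ _).trans hU)
  choose t ht using hfin
  have hopen : ∀ y, IsOpen (⋃ i ∈ t y, U i) := fun y => isOpen_biUnion fun i _ => hUo i
  -- The points whose whole fibre lies in the finite union form an open set, because `f` is closed.
  obtain ⟨s, hs, hsu⟩ := LindelofSpace.elim_nhds_subcover
    (fun y => (f '' (⋃ i ∈ t y, U i)ᶜ)ᶜ) fun y =>
      (hc _ (hopen y).isClosed_compl).isOpen_compl.mem_nhds (by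
        rintro ⟨x, hx, rfl⟩
        exact hx (ht _ rfl))
  refine ⟨⋃ y ∈ s, (t y : Set ι), hs.biUnion fun y _ => (t y).countable_toSet, fun x _ => ?_⟩
  have hx : f x ∈ ⋃ y ∈ s, (f '' (⋃ i ∈ t y, U i)ᶜ)ᶜ := hsu ▸ mem_univ _
  obtain ⟨y, hy, hxy⟩ := mem_iUnion₂.1 hx
  have hx' : x ∈ ⋃ i ∈ t y, U i := by
    by_contra h
    exact hxy ⟨x, h, rfl⟩
  obtain ⟨i, hi, hxi⟩ := mem_iUnion₂.1 hx'
  exact mem_iUnion₂.2 ⟨i, mem_iUnion₂.2 ⟨y, hy, hi⟩, hxi⟩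

end Perfect

/-! ### Separated families and gluing. -/

section Separated

/-- A pseudometric space which is not second countable contains an uncountable uniformly
separated set. -/
theorem exists_uncountable_separated {α : Type*} [PseudoMetricSpace α]
    (h : ¬ SecondCountableTopology α) :
    ∃ ε > (0 : ℝ), ∃ A : Set α, ¬ A.Countable ∧ A.Pairwise fun x y => ε ≤ dist x y := by
  by_contra! H
  refine h (Metric.secondCountable_of_almost_dense_set fun ε hε => ?_)
  obtain ⟨A, hA⟩ := zorn_subset {A : Set α | A.Pairwise fun x y => ε ≤ dist x y} fun c hc hcc =>
    ⟨⋃₀ c, (pairwise_sUnion hcc.directedOn).2 hc, fun s hs => subset_sUnion_of_mem hs⟩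
  refine ⟨A, ?_, fun x => ?_⟩
  · by_contra hcount
    obtain ⟨x, hx, y, hy, hxy, hlt⟩ : ∃ x ∈ A, ∃ y ∈ A, x ≠ y ∧ dist x y < ε := by
      have := H ε hε A hcount
      simpa [Set.Pairwise] using this
    exact absurd (hA.1 hx hy hxy) (not_le.2 hlt)
  · by_contra! hx
    have hins : insert x A ∈ {A : Set α | A.Pairwise fun x y => ε ≤ dist x y} :=
      (pairwise_insert).2
        ⟨hA.1, fun y hy _ => ⟨(hx y hy).le, (dist_comm x y ▸ hx y hy).le⟩⟩
    have hmem : x ∈ A := hA.2 hins (subset_insert _ _) (mem_insert _ _)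
    have := hx x hmem
    rw [dist_self] at this
    exact absurd hε (not_lt.2 this.le)

/-- A uniformly separated family in a separable pseudometric space is countable. -/
theorem countable_of_separated {α J : Type*} [PseudoMetricSpace α] [SeparableSpace α]
    {ε : ℝ} (hε : 0 < ε) (ψ : J → α) (hψ : Pairwise fun i j => ε ≤ dist (ψ i) (ψ j)) :
    Countable J := by
  refine Pairwise.countable_of_isOpen_disjoint (s := fun i => Metric.ball (ψ i) (ε / 2)) ?_
    (fun i => Metric.isOpen_ball) fun i => ⟨ψ i, Metric.mem_ball_self (by positivity)⟩
  intro i j hij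
  exact Metric.ball_disjoint_ball (by linarith [hψ hij])

/-- Two uncountable sets contain uncountable families indexed by the same type. -/
theorem exists_common_uncountable_index {α β : Type u} {A : Set α} {B : Set β}
    (hA : ¬ A.Countable) (hB : ¬ B.Countable) :
    ∃ (J : Type u) (a : J → α) (b : J → β), Uncountable J ∧ a.Injective ∧ b.Injective ∧
      (∀ j, a j ∈ A) ∧ ∀ j, b j ∈ B := by
  have hA' : Uncountable A := by rwa [← not_countable_iff, countable_coe_iff]
  have hB' : Uncountable B := by rwa [← not_countable_iff, countable_coe_iff]
  rcases Function.Embedding.total A B with ⟨⟨e⟩⟩ | ⟨⟨e⟩⟩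
  · exact ⟨A, Subtype.val, fun j => e j, hA', Subtype.val_injective,
      Subtype.val_injective.comp e.injective, fun j => j.2, fun j => (e j).2⟩
  · exact ⟨B, fun j => e j, Subtype.val, hB', Subtype.val_injective.comp e.injective,
      Subtype.val_injective, fun j => (e j).2, fun j => j.2⟩

/-- Prescribing continuous functions near the points of a uniformly separated family: the local
pieces glue to a continuous function. -/
theorem exists_continuous_glue {X Y J : Type*} [TopologicalSpace X] [PseudoMetricSpace Y]
    {p : X → Y} (hp : Continuous p) {ε : ℝ} (hε : 0 < ε) (y : J → Y)
    (hy : Pairwise fun i j => ε ≤ dist (y i) (y j)) (φ : J → X → ℝ)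
    (hφ : ∀ j, Continuous (φ j)) :
    ∃ f : X → ℝ, Continuous f ∧ ∀ j x, p x = y j → f x = φ j x := by
  -- The bump is `1` over `y j` and vanishes from distance `ε / 4` on. Two supports meeting one `ε /
  -- 4`-ball would join their centres by four steps shorter than `ε / 4`.
  let b : J → X → ℝ := fun j x => max 0 (1 - dist (p x) (y j) * (4 / ε)) * φ j x
  have hb : ∀ j, Function.support (b j) ⊆ {x | dist (p x) (y j) < ε / 4} := by
    intro j x hx
    by_contra h
    simp only [mem_ofPred_eq, not_lt] at h
    refine hx ?_
    have : max 0 (1 - dist (p x) (y j) * (4 / ε)) = 0 := by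
      refine max_eq_left ?_
      have : 1 ≤ dist (p x) (y j) * (4 / ε) := by
        rw [mul_div_assoc', le_div_iff₀ hε]
        linarith
      linarith
    simp [b, this]
  have hlf : LocallyFinite fun j => Function.support (b j) := by
    intro x
    refine ⟨{z | dist (p z) (p x) < ε / 4}, ?_, Set.Subsingleton.finite ?_⟩
    · exact (isOpen_lt (by fun_prop) continuous_const).mem_nhds (by simpa using hε)
    · rintro i ⟨z, hz, hz'⟩ j ⟨w, hw, hw'⟩
      by_contra hij
      have h1 := hb i hz
      have h2 := hb j hw
      simp only [mem_ofPred_eq] at h1 h2 hz' hw'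
      have := hy hij
      have t1 := dist_triangle (y i) (p z) (y j)
      have t2 := dist_triangle (p z) (p x) (y j)
      have t3 := dist_triangle (p x) (p w) (y j)
      rw [dist_comm (y i) (p z)] at t1
      rw [dist_comm (p x) (p w)] at t3
      linarith
  refine ⟨fun x => ∑ᶠ j, b j x, continuous_finsum (fun j => ?_) hlf, fun j x hx => ?_⟩
  · have := hφ j
    fun_prop
  · change ∑ᶠ j, b j x = _
    rw [finsum_eq_single _ j]
    · simp [b, hx]
    · intro i hij
      by_contra h
      have h1 := hb i h
      simp only [mem_ofPred_eq, hx] at h1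
      have := hy hij.symm
      linarith

end Separated

/-! ### Metrizable or Lindelöf. -/

section Dichotomy

theorem exists_continuous_ne {X : Type*} [TopologicalSpace X] [T0Space X]
    [CompletelyRegularSpace X] {x y : X} (h : x ≠ y) :
    ∃ φ : C(X, ℝ), φ x ≠ φ y := by
  obtain ⟨U, hU, hxy⟩ := exists_isOpen_xor_mem h
  wlog hx : x ∈ U generalizing x y
  · obtain ⟨φ, hφ⟩ := this h.symm hxy.symm (hxy.or.resolve_left hx)
    exact ⟨φ, hφ.symm⟩
  have hy : y ∉ U := fun hy => hxy.elim (fun H => H.2 hy) fun H => H.2 hx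
  obtain ⟨f, hf, hfx, hfy⟩ := CompletelyRegularSpace.completely_regular_isOpen x U hU hx
  refine ⟨⟨fun z => (f z : ℝ), by fun_prop⟩, ?_⟩
  simp [hfx, hfy hy]

theorem metrizableSpace_pi_of_countable {ι : Type*} [Countable ι] {X : ι → Type*}
    [∀ i, TopologicalSpace (X i)] [∀ i, MetrizableSpace (X i)] : MetrizableSpace (∀ i, X i) := by
  let := fun i => metrizableSpaceMetric (X i)
  exact UniformSpace.metrizableSpace

variable {G : Type u} [Group G] [TopologicalSpace G]

/-- A `PM`-factorizable group is metrizable if it has a proper homomorphism to a metrizable group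
such that countably many continuous functions separate `1` from the other points of the kernel. -/
theorem PMFactorizable.metrizableSpace_of_separating (hG : PMFactorizable G) {H : Type*}
    [Group H] [TopologicalSpace H] [MetrizableSpace H] {π : G →* H} (hπ : IsProperMap π)
    (φ : ℕ → G → ℝ) (hφ : ∀ n, Continuous (φ n))
    (hsep : ∀ x, π x = 1 → (∀ n, φ n x = φ n 1) → x = 1) : MetrizableSpace G := by
  choose M _ _ _ _ p g hp hg hfac using fun n => hG (φ n) (hφ n)
  let q : G →* H × (∀ n, M n) := π.prod (MonoidHom.pi p)
  have hqc : Continuous q := hπ.continuous.prodMk (continuous_pi fun n => (hp n).continuous)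
  -- Adding coordinates in a Hausdorff target keeps a proper map proper.
  have hq : IsProperMap q :=
    isProperMap_of_comp_of_t2 hqc continuous_fst (g := Prod.fst) hπ
  have hinj : Function.Injective q := by
    refine (injective_iff_map_eq_one q).2 fun x hx => hsep x (congrArg Prod.fst hx) fun n => ?_
    have hn : p n x = 1 := congrFun (congrArg Prod.snd hx) n
    rw [hfac n, Function.comp_apply, Function.comp_apply, hn, map_one]
  have := metrizableSpace_pi_of_countable (X := M)
  exact (IsClosedEmbedding.of_continuous_injective_isClosedMap hqc hinj
    hq.isClosedMap).isEmbedding.metrizableSpace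

/-- A `PM`-factorizable group is metrizable or Lindelöf. -/
theorem PMFactorizable.metrizableSpace_or_lindelofSpace [IsTopologicalGroup G] [T2Space G]
    (hG : PMFactorizable G) : MetrizableSpace G ∨ LindelofSpace G := by
  obtain ⟨H, _, _, _, _, π, -, hπ, -, -⟩ := hG (fun _ => 0) continuous_const
  let := metrizableSpaceMetric H
  by_cases hH : SecondCountableTopology H
  · exact Or.inr hπ.isProperMap.lindelofSpace
  left
  obtain ⟨δ, hδ, B, hBc, hB⟩ := exists_uncountable_separated hH
  let K : Set G := π ⁻¹' {1}
  have : CompactSpace K := isCompact_iff_compactSpace.1 (hπ.isCompact_fiber 1)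
  let R : Set C(K, ℝ) := range fun φ : C(G, ℝ) => φ.restrict K
  by_cases hR : SecondCountableTopology R
  · have : Nonempty R := ⟨⟨_, ⟨0, rfl⟩⟩⟩
    choose φ hφ using fun n => (denseSeq R n).2
    refine hG.metrizableSpace_of_separating hπ.isProperMap (fun n => φ n) (fun n => (φ n).continuous)
      fun x hx hxn => ?_
    by_contra hne
    let := IsTopologicalGroup.rightUniformSpace G
    obtain ⟨ψ, hψ⟩ := exists_continuous_ne hne
    -- At half the gap between `ψ x` and `ψ 1`, the approximant cannot take equal values at `x` and
    -- `1`.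
    obtain ⟨n, hn⟩ := (denseRange_denseSeq R).exists_dist_lt ⟨_, ⟨ψ, rfl⟩⟩
      (half_pos (dist_pos.2 hψ))
    rw [Subtype.dist_eq, ← hφ n] at hn
    have h1 := (ContinuousMap.dist_apply_le_dist (⟨x, hx⟩ : K)).trans_lt hn
    have h2 := (ContinuousMap.dist_apply_le_dist (⟨1, map_one π⟩ : K)).trans_lt hn
    simp only [ContinuousMap.restrict_apply] at h1 h2
    have h3 := dist_triangle_right (ψ x) (ψ 1) (φ n x)
    rw [hxn n] at h3 h1
    linarith
  · exfalso
    obtain ⟨ε, hε, A, hAc, hA⟩ := exists_uncountable_separated hR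
    obtain ⟨J, a, b, hJ, ha, hb, haA, hbB⟩ := exists_common_uncountable_index hAc hBc
    choose φ hφ using fun j => (a j).2
    choose x hx using fun j => hπ.surjective (b j)
    -- On the coset `x j * K`, `f` is a translate of `φ j`.
    obtain ⟨f, hf, hfφ⟩ := exists_continuous_glue hπ.continuous hδ b
      (fun i j hij => hB (hbB i) (hbB j) (hb.ne hij)) (fun j z => φ j ((x j)⁻¹ * z))
      (fun j => (φ j).continuous.comp (continuous_const_mul _))
    obtain ⟨M, _, _, _, _, p, g, hp, hg, rfl⟩ := hG f hf
    let := metrizableSpaceMetric M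
    let L : Set M := p '' K
    have : CompactSpace L :=
      isCompact_iff_compactSpace.1 ((hπ.isCompact_fiber 1).image hp.continuous)
    let ψ : J → C(L, ℝ) := fun j => ⟨fun l => g (p (x j) * l), by fun_prop⟩
    have hval : ∀ j (k : G) (hk : k ∈ K), φ j k = ψ j ⟨p k, k, hk, rfl⟩ := by
      intro j k hk
      have hk' : π k = 1 := hk
      have := hfφ j (x j * k) (by rw [map_mul, hk', mul_one, hx])
      simpa [ψ] using this.symm
    refine not_countable_iff.2 hJ (countable_of_separated hε ψ fun i j hij => ?_)
    refine (hA (haA i) (haA j) (ha.ne hij)).trans ?_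
    rw [Subtype.dist_eq, ← hφ i, ← hφ j, ContinuousMap.dist_le dist_nonneg]
    rintro ⟨k, hk⟩
    simp only [ContinuousMap.restrict_apply]
    rw [hval i k hk, hval j k hk]
    exact ContinuousMap.dist_apply_le_dist _

end Dichotomy

/-! ### Coarser first countable group topologies. -/

section Lindelof

/-- Every countable set is contained in a countable set closed under countably many binary
operations. -/
theorem exists_countable_closed_superset {α : Type*} (op : ℕ → α → α → α) {C : Set α}
    (hC : C.Countable) :
    ∃ D, C ⊆ D ∧ D.Countable ∧ ∀ n, ∀ x ∈ D, ∀ y ∈ D, op n x y ∈ D := by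
  let next : Set α → Set α := fun S => S ∪ ⋃ n, image2 (op n) S S
  let D : ℕ → Set α := fun k => next^[k] C
  have hsucc : ∀ k, D (k + 1) = next (D k) := fun k => Function.iterate_succ_apply' _ _ _
  have hmono : Monotone D := monotone_nat_of_le_succ fun k => by
    rw [hsucc]
    exact subset_union_left
  refine ⟨⋃ k, D k, subset_iUnion D 0, countable_iUnion fun k => ?_, fun n x hx y hy => ?_⟩
  · induction k with
    | zero => exact hC
    | succ k ih =>
      rw [hsucc]
      exact ih.union (countable_iUnion fun n => ih.image2 ih _)
  · obtain ⟨i, hi⟩ := mem_iUnion.1 hx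
    obtain ⟨j, hj⟩ := mem_iUnion.1 hy
    refine mem_iUnion.2 ⟨max i j + 1, ?_⟩
    rw [hsucc]
    exact Or.inr (mem_iUnion.2 ⟨n, mem_image2_of_mem (hmono (le_max_left i j) hi)
      (hmono (le_max_right i j) hj)⟩)

/-- A neighbourhood of the slice `X × {b}`, with `X` Lindelöf, contains, over each point of `X`,
one of countably many neighbourhoods of `b`. -/
theorem exists_seq_nhds_slice {X Y : Type*} [TopologicalSpace X] [TopologicalSpace Y]
    [LindelofSpace X] [Nonempty X] {b : Y} {O : Set (X × Y)} (hO : ∀ x, O ∈ 𝓝 (x, b)) :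
    ∃ w : ℕ → Set Y, (∀ n, w n ∈ 𝓝 b) ∧ ∀ x, ∃ n, ∀ y ∈ w n, (x, y) ∈ O := by
  choose U hU W hW hUW using fun x => mem_nhds_prod_iff.1 (hO x)
  obtain ⟨s, hs, hsu⟩ := LindelofSpace.elim_nhds_subcover U hU
  have hmem : ∀ x, ∃ z ∈ s, x ∈ U z := fun x => by
    have : x ∈ ⋃ z ∈ s, U z := hsu ▸ mem_univ x
    simpa using this
  obtain ⟨z, hz, -⟩ := hmem (Classical.arbitrary X)
  obtain ⟨e, rfl⟩ := hs.exists_eq_range ⟨z, hz⟩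
  refine ⟨fun n => W (e n), fun n => hW _, fun x => ?_⟩
  obtain ⟨_, ⟨n, rfl⟩, hx⟩ := hmem x
  exact ⟨n, fun y hy => hUW _ ⟨hx, hy⟩⟩

variable {G : Type u} [Group G]

/-- On a Lindelöf group, each sequence of neighbourhoods of `1` is refined by a countable group
filter basis of neighbourhoods of `1`. -/
theorem exists_countable_groupFilterBasis [TopologicalSpace G] [IsTopologicalGroup G]
    [LindelofSpace G] (V : ℕ → Set G) (hV : ∀ n, V n ∈ 𝓝 (1 : G)) :
    ∃ B : GroupFilterBasis G, B.sets.Countable ∧ (∀ U ∈ B, U ∈ 𝓝 (1 : G)) ∧ ∀ n, V n ∈ B := by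
  have hsq : ∀ U : {U : Set G // U ∈ 𝓝 1}, ∃ W : {U : Set G // U ∈ 𝓝 1}, W.1 * W.1 ⊆ U.1 := by
    intro U
    obtain ⟨W, hWo, hW1, hW⟩ := exists_open_nhds_one_mul_subset U.2
    exact ⟨⟨W, hWo.mem_nhds hW1⟩, hW⟩
  have hconj : ∀ U : {U : Set G // U ∈ 𝓝 1}, ∃ w : ℕ → {U : Set G // U ∈ 𝓝 1},
      ∀ x, ∃ n, ∀ y ∈ (w n).1, x * y * x⁻¹ ∈ U.1 := by
    intro U
    obtain ⟨w, hw, hwU⟩ := exists_seq_nhds_slice (b := (1 : G))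
      (O := (fun q : G × G => q.1 * q.2 * q.1⁻¹) ⁻¹' U.1) fun x => by
        have : Continuous fun q : G × G => q.1 * q.2 * q.1⁻¹ := by fun_prop
        exact this.continuousAt.preimage_mem_nhds (by simpa using U.2)
    exact ⟨fun n => ⟨w n, hw n⟩, hwU⟩
  choose sq hsq using hsq
  choose cj hcj using hconj
  -- One operation per basis axiom. The Lindelöf property makes countably many neighbourhoods
  -- suffice for conjugation by all elements.
  let op : ℕ → {U : Set G // U ∈ 𝓝 1} → {U : Set G // U ∈ 𝓝 1} → {U : Set G // U ∈ 𝓝 1}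
    | 0, U, W => ⟨U.1 ∩ W.1, inter_mem U.2 W.2⟩
    | 1, U, _ => sq U
    | 2, U, _ => ⟨U.1⁻¹, inv_mem_nhds_one G U.2⟩
    | n + 3, U, _ => cj U n
  obtain ⟨D, hCD, hDc, hD⟩ := exists_countable_closed_superset op
    (countable_range fun n => (⟨V n, hV n⟩ : {U : Set G // U ∈ 𝓝 1}))
  refine ⟨
    { sets := Subtype.val '' D
      nonempty := ⟨_, mem_image_of_mem _ (hCD (mem_range_self 0))⟩
      inter_sets := ?_
      one' := ?_
      mul' := ?_
      inv' := ?_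
      conj' := ?_ }, hDc.image _, ?_, fun n => mem_image_of_mem _ (hCD (mem_range_self n))⟩
  · rintro _ _ ⟨U, hU, rfl⟩ ⟨W, hW, rfl⟩
    exact ⟨_, mem_image_of_mem _ (hD 0 U hU W hW), Subset.rfl⟩
  · rintro _ ⟨U, hU, rfl⟩
    exact mem_of_mem_nhds U.2
  · rintro _ ⟨U, hU, rfl⟩
    exact ⟨_, mem_image_of_mem _ (hD 1 U hU U hU), hsq U⟩
  · rintro _ ⟨U, hU, rfl⟩
    exact ⟨_, mem_image_of_mem _ (hD 2 U hU U hU), Subset.rfl⟩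
  · rintro x _ ⟨U, hU, rfl⟩
    obtain ⟨n, hn⟩ := hcj U x
    exact ⟨_, mem_image_of_mem _ (hD (n + 3) U hU U hU), hn⟩
  · rintro _ ⟨U, hU, rfl⟩
    exact U.2

/-- A continuous real function on a Lindelöf group is continuous for some coarser first countable
group topology. -/
theorem exists_coarser_firstCountable_continuous [tG : TopologicalSpace G] [IsTopologicalGroup G]
    [LindelofSpace G] {f : G → ℝ} (hf : Continuous f) :
    ∃ t : TopologicalSpace G, @IsTopologicalGroup G t _ ∧ @FirstCountableTopology G t ∧
      tG ≤ t ∧ @Continuous G ℝ t _ f := by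
  have hosc : ∀ n : ℕ, ∃ w : ℕ → Set G, (∀ k, w k ∈ 𝓝 (1 : G)) ∧
      ∀ x, ∃ k, ∀ y ∈ w k, dist (f (x * y)) (f x) < 1 / (n + 1 : ℝ) := fun n =>
    exists_seq_nhds_slice (b := (1 : G))
      (O := {q : G × G | dist (f (q.1 * q.2)) (f q.1) < 1 / (n + 1 : ℝ)}) fun x =>
        (isOpen_lt (by fun_prop) continuous_const).mem_nhds (by simp; positivity)
  choose w hw hwf using hosc
  obtain ⟨B, hBc, hB, hwB⟩ := exists_countable_groupFilterBasis
    (fun n => w n.unpair.1 n.unpair.2) fun n => hw _ _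
  refine ⟨B.topology, B.isTopologicalGroup, ?_, ?_, ?_⟩
  · refine @FirstCountableTopology.mk G B.topology fun x => ?_
    exact HasCountableBasis.isCountablyGenerated ⟨B.nhds_hasBasis x, hBc⟩
  · refine le_of_nhds_le_nhds fun x => (B.nhds_hasBasis x).ge_iff.2 fun U hU => ?_
    have hxU := smul_mem_nhds_smul x (hB U hU)
    rwa [smul_eq_mul, mul_one] at hxU
  · refine (@continuous_iff_continuousAt G ℝ B.topology _ f).2 fun x => ?_
    refine ((B.nhds_hasBasis x).tendsto_iff Metric.nhds_basis_ball).2 fun ε hε => ?_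
    obtain ⟨n, hn⟩ := exists_nat_one_div_lt hε
    obtain ⟨k, hk⟩ := hwf n x
    refine ⟨w n k, by simpa using hwB (Nat.pair n k), ?_⟩
    rintro _ ⟨y, hy, rfl⟩
    exact (hk y hy).trans hn

end Lindelof

/-! ### Factoring through metrizable groups. -/

section Factorization

/-- A `T0` topological group in which `1` has a countable neighbourhood basis is metrizable. -/
theorem IsTopologicalGroup.metrizableSpace_of_nhds_one (M : Type*) [Group M] [TopologicalSpace M]
    [IsTopologicalGroup M] [T0Space M] [h : (𝓝 (1 : M)).IsCountablyGenerated] :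
    MetrizableSpace M := by
  let := IsTopologicalGroup.rightUniformSpace M
  have : (uniformity M).IsCountablyGenerated :=
    Filter.comap.isCountablyGenerated (𝓝 (1 : M)) _
  exact UniformSpace.metrizableSpace

variable {G : Type u} [Group G]

/-- The largest Hausdorff quotient of a first countable topological group is a metrizable group
through which all continuous real functions factor. -/
theorem exists_metrizable_quotient [TopologicalSpace G] [IsTopologicalGroup G]
    [FirstCountableTopology G] {f : G → ℝ} (hf : Continuous f) :
    ∃ (M : Type u) (_ : Group M) (_ : TopologicalSpace M) (_ : IsTopologicalGroup M)
      (_ : MetrizableSpace M) (p : G →* M) (g : M → ℝ),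
      Continuous p ∧ Continuous g ∧ f = g ∘ p := by
  have : (𝓝 (1 : SeparationQuotient G)).IsCountablyGenerated := by
    rw [← SeparationQuotient.mk_one, ← SeparationQuotient.map_mk_nhds]
    infer_instance
  exact ⟨SeparationQuotient G, inferInstance, inferInstance, inferInstance,
    IsTopologicalGroup.metrizableSpace_of_nhds_one _, SeparationQuotient.mkMonoidHom,
    SeparationQuotient.lift f fun x y h => (h.map hf).eq, SeparationQuotient.continuous_mk,
    SeparationQuotient.continuous_lift hf, rfl⟩

theorem exists_metrizable_factor_of_lindelofSpace [TopologicalSpace G] [IsTopologicalGroup G]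
    [LindelofSpace G] {f : G → ℝ} (hf : Continuous f) :
    ∃ (M : Type u) (_ : Group M) (_ : TopologicalSpace M) (_ : IsTopologicalGroup M)
      (_ : MetrizableSpace M) (p : G →* M) (g : M → ℝ),
      Continuous p ∧ Continuous g ∧ f = g ∘ p := by
  obtain ⟨t, ht, hfc, hle, hft⟩ := exists_coarser_firstCountable_continuous hf
  obtain ⟨M, i₁, i₂, i₃, i₄, p, g, hp, hg, hfg⟩ := @exists_metrizable_quotient G _ t ht hfc f hft
  exact ⟨M, i₁, i₂, i₃, i₄, p, g, continuous_le_dom hle hp, hg, hfg⟩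

/-- A Lindelöf group with a proper homomorphism to a metrizable group is `PM`-factorizable. -/
theorem PMFactorizable.of_lindelofSpace [TopologicalSpace G] [IsTopologicalGroup G]
    [LindelofSpace G] {H : Type u} [Group H] [TopologicalSpace H] [IsTopologicalGroup H]
    [MetrizableSpace H] {π : G →* H} (hπ : IsProperMap π) : PMFactorizable G := by
  intro f hf
  obtain ⟨M, _, _, _, _, p, g, hp, hg, rfl⟩ := exists_metrizable_factor_of_lindelofSpace hf
  let q : G →* H × M := π.prod p
  have hqc : Continuous q := hπ.continuous.prodMk hp
  have hq : IsProperMap q :=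
    isProperMap_of_comp_of_t2 hqc continuous_fst (g := Prod.fst) hπ
  have hqr : IsProperMap q.rangeRestrict :=
    isProperMap_of_comp_of_inj (hqc.subtype_mk _) continuous_subtype_val hq
      Subtype.val_injective
  have : MetrizableSpace q.range := IsEmbedding.subtypeVal.metrizableSpace
  exact ⟨q.range, inferInstance, inferInstance, inferInstance, inferInstance, q.rangeRestrict,
    fun y => g y.1.2, isPerfectMap_iff.2 ⟨hqr, q.rangeRestrict_surjective⟩, by fun_prop, rfl⟩

theorem PMFactorizable.of_metrizableSpace [TopologicalSpace G] [IsTopologicalGroup G]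
    [MetrizableSpace G] : PMFactorizable G := fun f hf =>
  ⟨G, inferInstance, inferInstance, inferInstance, inferInstance, MonoidHom.id G, f,
    isPerfectMap_iff.2 ⟨isProperMap_id, Function.surjective_id⟩, hf, rfl⟩

/-- A Lindelöf `PM`-factorizable group is `PR`-factorizable. -/
theorem PMFactorizable.prFactorizable [TopologicalSpace G] [LindelofSpace G]
    (hG : PMFactorizable G) : PRFactorizable G := by
  intro f hf
  obtain ⟨H, _, _, _, _, π, g, hπ, hg, hfg⟩ := hG f hf
  let := metrizableSpaceMetric H
  have : LindelofSpace H := ⟨by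
    rw [← hπ.surjective.range_eq]
    exact isLindelof_range hπ.continuous⟩
  have : SecondCountableTopology H := by
    infer_instance
  exact ⟨H, inferInstance, inferInstance, inferInstance, inferInstance, inferInstance, π, g, hπ,
    hg, hfg⟩

end Factorization

theorem theorem4p2 {ι : Type v} [Countable ι] (G : ι → Type u) [∀ i, Group (G i)]
    [∀ i, TopologicalSpace (G i)] [∀ i, IsTopologicalGroup (G i)] [∀ i, T2Space (G i)]
    (hG : ∀ i, PMFactorizable (G i)) :
    PMFactorizable (∀ i, G i) ↔
      (∀ i, TopologicalSpace.MetrizableSpace (G i)) ∨ (∀ i, PRFactorizable (G i)) := by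
  classical
  constructor
  · intro h
    refine h.metrizableSpace_or_lindelofSpace.imp (fun hm i => ?_) fun hl i => ?_
    · have := hm
      exact (Function.LeftInverse.isEmbedding (f := Function.eval i) (g := Pi.mulSingle i)
        (fun x => Pi.mulSingle_eq_same i x) (continuous_apply i)
        (continuous_mulSingle i)).metrizableSpace
    · have := hl
      have : LindelofSpace (G i) := ⟨by
        rw [← (Function.surjective_eval (α := ι) (β := G) i).range_eq]
        exact isLindelof_range (continuous_apply i)⟩
      exact (hG i).prFactorizable
  · rintro (h | h)
    · have := metrizableSpace_pi_of_countable (X := G)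
      exact PMFactorizable.of_metrizableSpace
    -- Only the perfect homomorphisms matter here, so any function will do.
    · choose H _ _ _ _ _ π _ hπ _ _ using fun i => h i (fun _ => 0) continuous_const
      have hp : IsProperMap (MonoidHom.piMap π) := IsProperMap.pi_map fun i => (hπ i).isProperMap
      have := hp.lindelofSpace
      have : ∀ i, MetrizableSpace (H i) := fun i =>
        IsTopologicalGroup.metrizableSpace_of_nhds_one _
      have := metrizableSpace_pi_of_countable (X := H)
      exact PMFactorizable.of_lindelofSpace hp
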